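/- Consider the triangular lattice in the plane. A polyiamond is a finite nonempty set of triangular faces of the lattice that is edge-connected (two faces are adjacent if they share an edge; holes are allowed). Its area is the number of its faces, and its edge-perimeter $p(P)$ is the number of unit edges that separate a face of $P$ from a face not in $P$. For $r\ge 0$ and $0\le i\le 6$ let $E_{B_i}(r)$ be the set of faces obtained from the regular hexagon of side $r$ by moving $i$ of its bounding lines, consecutive in clockwise order, outwards by one lattice strip. For $r\ge1$ this attaches to the hexagon, one after the other in clockwise order, $i$ bars (rows) of triangles, which have successively $2r-1$, then four times $2r+1$, then $2r+3$ faces; $E_{B_6}(r)$ is the regular hexagon of side $r+1$. For $A\in\mathbb{N}$ put $r=\lfloor\sqrt{A/6}\rfloor$ and $l=A-6r^2$. If $l=0$ or $l<2r-1$ put $i=0$; otherwise let $i$ be the least $m\in\{1,2,3,4\}$ with $l<(2r-1)+m(2r+1)$ if there is one, and $i=5$ if there is none. Put $k=A-|E_{B_i}(r)|$. The standard polyiamond $S(A)$ is the union of $E_{B_i}(r)$ and the first $k$ faces, in clockwise order, of the next bar, i.e. the one that completes $E_{B_i}(r)$ to $E_{B_{i+1}}(r)$; it is determined by $A$ up to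 a lattice symmetry, and $S(0)=\emptyset$. Then for every $A\in\mathbb{N}$ the set $S(A)$ has area $A$ (and is a polyiamond if $A>0$), its edge-perimeter is $$p(S(A)) = 6r + i + \mathbb{1}_{\{k>0\}} + \mathbb{1}_{\{k>0,\ k\text{ even}\}},$$ and every polyiamond $P$ of area $A$ satisfies $p(P)\ge p(S(A))$. Hence standard polyiamonds minimize the edge-perimeter at fixed area. -/

import Mathlib

namespace Polyiamond

/-- A vertex of the triangular lattice: `(x, y)` stands for the point `x • e₁ + y • e₂` of the
plane, where `e₁ = (1, 0)` and `e₂ = (1/2, √3/2)`. -/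
abbrev Vertex : Type := ℤ × ℤ

/-- A triangular face of the lattice.  `(x, y, true)` is the upward triangle with corners
`(x, y), (x+1, y), (x, y+1)`; `(x, y, false)` is the downward triangle with corners
`(x+1, y), (x, y+1), (x+1, y+1)`. -/
abbrev Face : Type := ℤ × ℤ × Bool

/-- The three corners of a face. -/
def corners : Face → Finset Vertex
  | (x, y, true) => {(x, y), (x + 1, y), (x, y + 1)}
  | (x, y, false) => {(x + 1, y), (x, y + 1), (x + 1, y + 1)}

/-- The three unit edges of a face, an edge being the set of its two end points. -/
def edges (f : Face) : Finset (Finset Vertex) := (corners f).powersetCard 2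

/-- Two distinct faces are adjacent when they share an edge (a common corner is not enough). -/
def faceGraph : SimpleGraph Face where
  Adj f g := f ≠ g ∧ ∃ e, e ∈ edges f ∧ e ∈ edges g
  symm := ⟨fun _ _ h => ⟨h.1.symm, h.2.imp fun _ he => ⟨he.2, he.1⟩⟩⟩
  loopless := ⟨fun _ h => h.1 rfl⟩

/-- A polyiamond: a finite, nonempty, edge-connected set of faces.  Holes are allowed. -/
def IsPolyiamond (P : Finset Face) : Prop :=
  (faceGraph.induce (P : Set Face)).Connected

/-- The area is the number of faces. -/
def area (P : Finset Face) : ℕ := P.card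

open Classical in
/-- The boundary: the unit edges that separate a face in `P` from a face outside `P`. -/
noncomputable def boundary (P : Finset Face) : Finset (Finset Vertex) :=
  (P.biUnion edges).filter fun e => ∃ g : Face, g ∉ P ∧ e ∈ edges g

/-- The edge-perimeter. -/
noncomputable def perimeter (P : Finset Face) : ℕ := (boundary P).card

/-- The index of the strip `n ≤ x + y ≤ n + 1` that contains the face. -/
def diag : Face → ℤ
  | (x, y, true) => x + y
  | (x, y, false) => x + y + 1

/-- The quasi-regular hexagon made of the regular hexagon of radius `r` centred at the origin
(the faces whose three strip indices all lie in `[-r, r)`) and of `i ≤ 6` bars, attached one after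
the other to its sides in clockwise order, starting with the top side: each bar moves one of the
six bounding lines outwards by one unit. -/
noncomputable def quasiHexagon (r i : ℕ) : Finset Face :=
  (Finset.Icc (-(r : ℤ) - 1) r ×ˢ (Finset.Icc (-(r : ℤ) - 1) r ×ˢ Finset.univ)).filter fun f =>
    f.2.1 < (r : ℤ) + (if 1 ≤ i then 1 else 0) ∧
    diag f < (r : ℤ) + (if 2 ≤ i then 1 else 0) ∧
    f.1 < (r : ℤ) + (if 3 ≤ i then 1 else 0) ∧
    -(r : ℤ) - (if 4 ≤ i then 1 else 0) ≤ f.2.1 ∧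
    -(r : ℤ) - (if 5 ≤ i then 1 else 0) ≤ diag f ∧
    -(r : ℤ) - (if 6 ≤ i then 1 else 0) ≤ f.1

/-- The clockwise rotation by `π/3` about the origin, acting on faces.
On vertices it is `(x, y) ↦ (x + y, -x)`. -/
def rotate : Face → Face
  | (x, y, true) => (x + y, -x - 1, false)
  | (x, y, false) => (x + y + 1, -x - 1, true)

/-- The `n`-th face, counted clockwise (from left to right) from `n = 0`, of a bar lying on top of
the line `y = r`, whose larger base starts at the vertex `(s, r)`. -/
def topBarFace (r : ℕ) (s : ℤ) (n : ℕ) : Face :=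
  (s + (n / 2 : ℕ), (r : ℤ), decide (Even n))

/-- The first `k` faces, in clockwise order, of the bar that is attached to `quasiHexagon r i`
in order to build `quasiHexagon r (i + 1)`, for `i ≤ 5`.  It lies along the side obtained from the
top side by `i` rotations.  The larger base of the very first bar (`i = 0`) starts at the corner
`(-r, r)` of the hexagon; those of the following bars start one unit earlier, on the bar
attached just before. -/
def incompleteBar (r i k : ℕ) : Finset Face :=
  (Finset.range k).image fun n =>
    rotate^[i] (topBarFace r (if i = 0 then -(r : ℤ) else -(r : ℤ) - 1) n)

/-- The radius `r = ⌊√(A / 6)⌋`. -/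
def radius (A : ℕ) : ℕ := Nat.sqrt (A / 6)

/-- The number `i ∈ {0, …, 5}` of complete bars.  The bars attached successively to the regular
hexagon of radius `r` have `2r - 1`, then four times `2r + 1`, then `2r + 3` faces. -/
def barCount (A : ℕ) : ℕ :=
  let r : ℤ := radius A
  let l : ℤ := A - 6 * r ^ 2
  if l = 0 then 0
  else if l < 2 * r - 1 then 0
  else if l < (2 * r - 1) + (2 * r + 1) then 1
  else if l < (2 * r - 1) + 2 * (2 * r + 1) then 2
  else if l < (2 * r - 1) + 3 * (2 * r + 1) then 3
  else if l < (2 * r - 1) + 4 * (2 * r + 1) then 4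
  else 5

/-- The number `k` of faces in the last, incomplete bar: what remains of `A` after
the hexagon and the complete bars. -/
noncomputable def remainder (A : ℕ) : ℕ := A - area (quasiHexagon (radius A) (barCount A))

/-- The standard polyiamond `S(A)`. -/
noncomputable def standard (A : ℕ) : Finset Face :=
  quasiHexagon (radius A) (barCount A) ∪ incompleteBar (radius A) (barCount A) (remainder A)

end Polyiamond

namespace Polyiamond

/-! Minimality combines the isoperimetric inequality `6 * A ≤ p ^ 2` with the congruence `p ≡ A` mod
2 (`perimeter_mod_two`).

For the inequality (`IsPolyiamond.six_mul_card_le`), let a, b, c be the numbers of rows met in the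
three directions. A row has a boundary edge at each end, and every edge is crossed by rows of
exactly two directions, so a + b + c ≤ p (`card_rows_le_perimeter`). By connectedness the rows met
form intervals, so the polyiamond lies in an a × b parallelogram of 2ab faces without two opposite
corner triangles, of sides s and t with s + t = a + b - c. Hence A ≤ 2ab - s² - t² ≤ (a + b + c)² /
6.

For S(A), a face glued along m edges changes the perimeter by 3 - 2m (`perimeter_insert`). Along a
bar the changes are +1, +1, -1, +1, -1, ..., so a complete bar, of odd length, costs one
(`union_incompleteBar`, `quasiHexagon_step`). The resulting value v satisfies (v - 2)² < 6A, and
parity excludes v - 1 (`le_of_six_mul_le_sq`). -/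

/-! ### Edges and adjacency in coordinates -/

/-- The face on the other side of the `j`-th edge of a face. -/
def flip : Fin 3 → Face → Face
  | 0, (x, y, b) => (x, y, !b)
  | 1, (x, y, true) => (x - 1, y, false)
  | 1, (x, y, false) => (x + 1, y, true)
  | 2, (x, y, true) => (x, y - 1, false)
  | 2, (x, y, false) => (x, y + 1, true)

/-- The `j`-th edge of a face. -/
def edge : Fin 3 → Face → Finset Vertex
  | 0, (x, y, _) => {(x + 1, y), (x, y + 1)}
  | 1, (x, y, true) => {(x, y), (x, y + 1)}
  | 1, (x, y, false) => {(x + 1, y), (x + 1, y + 1)}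
  | 2, (x, y, true) => {(x, y), (x + 1, y)}
  | 2, (x, y, false) => {(x, y + 1), (x + 1, y + 1)}

theorem flip_flip (j : Fin 3) (f : Face) : flip j (flip j f) = f := by
  obtain ⟨x, y, b⟩ := f
  fin_cases j <;> cases b <;> simp [flip]

theorem flip_ne (j : Fin 3) (f : Face) : flip j f ≠ f := by
  obtain ⟨x, y, b⟩ := f
  fin_cases j <;> cases b <;> simp [flip]

theorem edge_flip (j : Fin 3) (f : Face) : edge j (flip j f) = edge j f := by
  obtain ⟨x, y, b⟩ := f
  fin_cases j <;> cases b <;> simp [flip, edge]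

/-- Twice the midpoint of the `j`-th edge of a face. -/
theorem sum_edge (j : Fin 3) (x y : ℤ) (b : Bool) : ∑ v ∈ edge j (x, y, b), v =
    match j, b with
    | 0, _ => (2 * x + 1, 2 * y + 1)
    | 1, true => (2 * x, 2 * y + 1)
    | 1, false => (2 * x + 2, 2 * y + 1)
    | 2, true => (2 * x + 1, 2 * y)
    | 2, false => (2 * x + 1, 2 * y + 2) := by
  fin_cases j <;> cases b <;> simp only [edge] <;> rw [Finset.sum_pair (by simp)] <;>
    simp <;> omega

/-- The parities of the doubled midpoint determine the direction of the edge, and its value leaves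
only the two faces on either side. -/
theorem edge_eq_edge {i j : Fin 3} {f g : Face} (h : edge i f = edge j g) :
    i = j ∧ (g = f ∨ g = flip i f) := by
  obtain ⟨x, y, b⟩ := f
  obtain ⟨x', y', b'⟩ := g
  have h' : ∑ v ∈ edge i (x, y, b), v = ∑ v ∈ edge j (x', y', b'), v := by rw [h]
  rw [sum_edge, sum_edge] at h'
  fin_cases i <;> fin_cases j <;> cases b <;> cases b' <;> simp [flip] at h' ⊢ <;> omega

theorem mem_edges {e : Finset Vertex} {f : Face} : e ∈ edges f ↔ ∃ j, edge j f = e := by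
  obtain ⟨x, y, b⟩ := f
  have key : ∀ a b c : Vertex, a ≠ b → a ≠ c → b ≠ c →
      (({a, b, c} : Finset Vertex).powersetCard 2) = {{a, b}, {a, c}, {b, c}} := by
    intro a b c hab hac hbc
    symm
    apply Finset.eq_of_subset_of_card_le
    · intro s hs
      simp only [Finset.mem_insert, Finset.mem_singleton] at hs
      rw [Finset.mem_powersetCard]
      rcases hs with rfl | rfl | rfl
      · exact ⟨by intro; simp; tauto, Finset.card_pair hab⟩
      · exact ⟨by intro; simp; tauto, Finset.card_pair hac⟩
      · exact ⟨by intro; simp; tauto, Finset.card_pair hbc⟩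
    · rw [Finset.card_powersetCard, Finset.card_eq_three.2 ⟨a, b, c, hab, hac, hbc, rfl⟩]
      have h1 : ({a, b} : Finset Vertex) ≠ {a, c} := fun h => by
        have : b ∈ ({a, c} : Finset Vertex) := h ▸ by simp
        simp at this; tauto
      have h2 : ({a, b} : Finset Vertex) ≠ {b, c} := fun h => by
        have : a ∈ ({b, c} : Finset Vertex) := h ▸ by simp
        simp at this; tauto
      have h3 : ({a, c} : Finset Vertex) ≠ {b, c} := fun h => by
        have : a ∈ ({b, c} : Finset Vertex) := h ▸ by simp
        simp at this; tauto
      rw [Finset.card_eq_three.2 ⟨_, _, _, h1, h2, h3, rfl⟩]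
      decide
  cases b
  · simp only [edges, corners]
    rw [key _ _ _ (by simp) (by simp) (by simp)]
    simp only [Finset.mem_insert, Finset.mem_singleton, Fin.exists_fin_succ, edge,
      Fin.isValue, Fin.succ_zero_eq_one, Fin.succ_one_eq_two, IsEmpty.exists_iff, or_false]
    simp only [eq_comm]
  · simp only [edges, corners]
    rw [key _ _ _ (by simp) (by simp) (by simp)]
    simp only [Finset.mem_insert, Finset.mem_singleton, Fin.exists_fin_succ, edge,
      Fin.isValue, Fin.succ_zero_eq_one, Fin.succ_one_eq_two, IsEmpty.exists_iff, or_false]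
    simp only [eq_comm]
    tauto

theorem faceGraph_adj {f g : Face} : faceGraph.Adj f g ↔ ∃ j, g = flip j f := by
  constructor
  · rintro ⟨hne, e, he, he'⟩
    obtain ⟨i, rfl⟩ := mem_edges.1 he
    obtain ⟨j, hj⟩ := mem_edges.1 he'
    obtain ⟨-, h | h⟩ := edge_eq_edge hj.symm
    · exact absurd h.symm hne
    · exact ⟨i, h⟩
  · rintro ⟨j, rfl⟩
    exact ⟨(flip_ne j f).symm, edge j f, mem_edges.2 ⟨j, rfl⟩, mem_edges.2 ⟨j, edge_flip j f⟩⟩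

/-! ### Perimeter as a count of face–neighbour pairs -/

/-- The perimeter counts the pairs of a face of `P` and an adjacent face outside `P`. -/
theorem perimeter_eq_sum (P : Finset Face) :
    perimeter P = ∑ j, (P.filter fun f => flip j f ∉ P).card := by
  have h : boundary P =
      ((Finset.univ.sigma fun j => P.filter fun f => flip j f ∉ P).image
        fun q => edge q.1 q.2) := by
    ext e
    simp only [boundary, Finset.mem_filter, Finset.mem_biUnion, Finset.mem_image,
      Finset.mem_sigma, Finset.mem_univ, true_and, Sigma.exists]
    constructor
    · rintro ⟨⟨f, hf, he⟩, g, hg, he'⟩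
      obtain ⟨i, rfl⟩ := mem_edges.1 he
      obtain ⟨j, hj⟩ := mem_edges.1 he'
      obtain ⟨-, h | h⟩ := edge_eq_edge hj.symm
      · exact absurd (h ▸ hf) hg
      · exact ⟨i, f, ⟨hf, h ▸ hg⟩, rfl⟩
    · rintro ⟨j, f, ⟨hf, hg⟩, rfl⟩
      exact ⟨⟨f, hf, mem_edges.2 ⟨j, rfl⟩⟩, flip j f, hg, mem_edges.2 ⟨j, edge_flip j f⟩⟩
  rw [perimeter, h, Finset.card_image_of_injOn, Finset.card_sigma]
  rintro ⟨i, f⟩ hf ⟨j, g⟩ hg hfg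
  simp only [Finset.coe_sigma, Set.mem_sigma_iff, Finset.mem_coe, Finset.mem_filter] at hf hg
  obtain ⟨rfl, h | h⟩ := edge_eq_edge hfg
  · dsimp only at h
    rw [h]
  · exact absurd (h ▸ hg.2.1) hf.2.2

/-- How adding a face changes the number of boundary edges in direction `j`. -/
theorem card_filter_flip_insert (j : Fin 3) {P : Finset Face} {f : Face} (hf : f ∉ P) :
    ((insert f P).filter fun g => flip j g ∉ insert f P).card + (if flip j f ∈ P then 2 else 0) =
      (P.filter fun g => flip j g ∉ P).card + 1 := by
  have hflip : ∀ g, flip j g = f ↔ g = flip j f := fun g =>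
    ⟨fun h => by rw [← h, flip_flip], fun h => by rw [h, flip_flip]⟩
  split_ifs with h
  · have h1 : (P.filter fun g => flip j g ∉ P) =
        insert (flip j f) ((insert f P).filter fun g => flip j g ∉ insert f P) := by
      ext g
      simp only [Finset.mem_filter, Finset.mem_insert, hflip, not_or]
      constructor
      · tauto
      · rintro (rfl | ⟨rfl | hg, h1, h2⟩)
        · rw [flip_flip]; exact ⟨h, hf⟩
        · exact absurd h h2
        · exact ⟨hg, h2⟩
    rw [h1, Finset.card_insert_of_notMem]
    simp [flip_flip]
  · have h1 : ((insert f P).filter fun g => flip j g ∉ insert f P) =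
        insert f (P.filter fun g => flip j g ∉ P) := by
      ext g
      simp only [Finset.mem_filter, Finset.mem_insert, hflip, not_or]
      constructor
      · tauto
      · rintro (rfl | ⟨hg, h2⟩)
        · exact ⟨Or.inl rfl, (flip_ne j g).symm, h⟩
        · exact ⟨Or.inr hg, fun h3 => h (h3 ▸ hg), h2⟩
    rw [h1, Finset.card_insert_of_notMem (by simp [hf])]

theorem perimeter_insert {P : Finset Face} {f : Face} (hf : f ∉ P) :
    perimeter (insert f P) + 2 * (Finset.univ.filter fun j => flip j f ∈ P).card =
      perimeter P + 3 := by
  have h : ∀ j, _ := fun j => card_filter_flip_insert j hf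
  rw [perimeter_eq_sum, perimeter_eq_sum, Finset.card_filter, Finset.mul_sum]
  have h2 := Finset.sum_congr (s₁ := (Finset.univ : Finset (Fin 3))) rfl fun j _ => h j
  rw [Finset.sum_add_distrib, Finset.sum_add_distrib] at h2
  simpa using h2

theorem perimeter_empty : perimeter ∅ = 0 := by simp [perimeter_eq_sum]

theorem perimeter_mod_two (P : Finset Face) : perimeter P % 2 = P.card % 2 := by
  induction P using Finset.induction_on with
  | empty => simp [perimeter_empty]
  | insert f P hf ih =>
    have := perimeter_insert hf
    rw [Finset.card_insert_of_notMem hf]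
    omega

/-! ### Rows and the perimeter -/

/-- If `next` moves along the rows given by `row`, each row that meets `P` contains a face of `P`
whose successor is outside `P`. -/
theorem card_image_le_card_filter_next (P : Finset Face) (row pos : Face → ℤ)
    (next : Face → Face) (hrow : ∀ f, row (next f) = row f) (hpos : ∀ f, pos f < pos (next f)) :
    (P.image row).card ≤ (P.filter fun f => next f ∉ P).card := by
  refine le_trans (Finset.card_le_card ?_) (Finset.card_image_le (f := row))
  intro m hm
  obtain ⟨f, hf, rfl⟩ := Finset.mem_image.1 hm
  obtain ⟨g, hg, hmax⟩ := (P.filter fun g => row g = row f).exists_max_image pos ⟨f, by simp [hf]⟩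
  rw [Finset.mem_filter] at hg
  refine Finset.mem_image.2 ⟨g, Finset.mem_filter.2 ⟨hg.1, fun h => ?_⟩, hg.2⟩
  exact absurd (hmax _ (Finset.mem_filter.2 ⟨h, (hrow g).trans hg.2⟩)) (not_le.2 (hpos g))

/-- A row that is crossed by the edges in the directions `i` and `j` contributes at least two
boundary edges. -/
theorem two_mul_card_image_le (P : Finset Face) (row pos : Face → ℤ) (i j : Fin 3)
    (hi : ∀ f, row (flip i f) = row f) (hj : ∀ f, row (flip j f) = row f)
    (hpos : ∀ f, (pos (flip i f) < pos f ∧ pos f < pos (flip j f)) ∨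
      (pos (flip j f) < pos f ∧ pos f < pos (flip i f))) :
    2 * (P.image row).card ≤
      (P.filter fun f => flip i f ∉ P).card + (P.filter fun f => flip j f ∉ P).card := by
  -- Up and down faces alternate along a row and are left forwards through different edges. `h1`
  -- steps forwards and `h2` backwards; together they use each of the two edges of each face once.
  have h1 := card_image_le_card_filter_next P row pos
    (fun f => if pos f < pos (flip i f) then flip i f else flip j f)
    (fun f => by split_ifs <;> simp [hi, hj])
    (fun f => by split_ifs <;> have := hpos f <;> omega)
  have h2 := card_image_le_card_filter_next P row (fun f => - pos f)
    (fun f => if pos f < pos (flip i f) then flip j f else flip i f)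
    (fun f => by split_ifs <;> simp [hi, hj])
    (fun f => by split_ifs <;> have := hpos f <;> omega)
  refine (two_mul _).trans_le ((add_le_add h1 h2).trans_eq ?_)
  simp only [Finset.card_filter, ← Finset.sum_add_distrib]
  refine Finset.sum_congr rfl fun f _ => ?_
  by_cases h : pos f < pos (flip i f) <;> simp [h, add_comm]

theorem diag_flip_one (f : Face) : diag (flip 1 f) = diag f := by
  obtain ⟨x, y, b⟩ := f
  cases b <;> simp [flip, diag] <;> omega

theorem diag_flip_two (f : Face) : diag (flip 2 f) = diag f := by
  obtain ⟨x, y, b⟩ := f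
  cases b <;> simp [flip, diag] <;> omega

/-- The perimeter is at least the number of rows met in the three directions. -/
theorem card_rows_le_perimeter (P : Finset Face) :
    (P.image fun f => f.1).card + (P.image fun f => f.2.1).card + (P.image diag).card ≤
      perimeter P := by
  have hx := two_mul_card_image_le P (fun f => f.1) (fun f => 2 * f.2.1 + (if f.2.2 then 0 else 1))
    0 2 (by rintro ⟨x, y, _ | _⟩ <;> simp [flip]) (by rintro ⟨x, y, _ | _⟩ <;> simp [flip])
    (by rintro ⟨x, y, _ | _⟩ <;> simp [flip] <;> omega)
  have hy := two_mul_card_image_le P (fun f => f.2.1) (fun f => 2 * f.1 + (if f.2.2 then 0 else 1))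
    0 1 (by rintro ⟨x, y, _ | _⟩ <;> simp [flip]) (by rintro ⟨x, y, _ | _⟩ <;> simp [flip])
    (by rintro ⟨x, y, _ | _⟩ <;> simp [flip] <;> omega)
  have hd := two_mul_card_image_le P diag (fun f => f.2.1 - f.1) 1 2
    diag_flip_one diag_flip_two
    (by rintro ⟨x, y, _ | _⟩ <;> simp [flip])
  -- Each edge direction occurs in two of `hx`, `hy`, `hd`, so their right-hand sides add up to
  -- twice the perimeter.
  rw [perimeter_eq_sum, Fin.sum_univ_three]
  omega

/-! ### The isoperimetric inequality -/

/-- Discrete intermediate value property for polyiamonds. -/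
theorem IsPolyiamond.exists_eq {P : Finset Face} (hP : IsPolyiamond P) (φ : Face → ℤ)
    (hφ : ∀ j f, φ (flip j f) ≤ φ f + 1) {f g : Face} (hf : f ∈ P) (hg : g ∈ P) {m : ℤ}
    (h1 : φ f ≤ m) (h2 : m ≤ φ g) : ∃ h ∈ P, φ h = m := by
  obtain ⟨w⟩ := hP.preconnected ⟨f, hf⟩ ⟨g, hg⟩
  have key : ∀ (u v : (P : Set Face)), (faceGraph.induce (P : Set Face)).Walk u v →
      φ u ≤ m → m ≤ φ v → ∃ h ∈ P, φ h = m := by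
    intro u v w
    induction w with
    | nil => exact fun h1 h2 => ⟨_, Subtype.prop _, le_antisymm h1 h2⟩
    | @cons u v w hadj _ ih =>
      intro h1 h2
      rcases h1.eq_or_lt with h | h
      · exact ⟨u, u.2, h⟩
      · obtain ⟨j, hj⟩ := faceGraph_adj.1 (SimpleGraph.induce_adj.1 hadj)
        refine ih ?_ h2
        have := hφ j u
        rw [← hj] at this
        omega
  exact key _ _ w h1 h2

/-- The rows of a polyiamond in one direction form an interval. -/
theorem IsPolyiamond.exists_extremes {P : Finset Face} (hP : IsPolyiamond P) (φ : Face → ℤ)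
    (hφ : ∀ j f, φ (flip j f) ≤ φ f + 1) : ∃ f ∈ P, ∃ g ∈ P, (∀ h ∈ P, φ f ≤ φ h ∧ φ h ≤ φ g) ∧
      φ g - φ f + 1 = (P.image φ).card := by
  have hne : P.Nonempty := by
    obtain ⟨f⟩ := hP.nonempty
    exact ⟨f, f.2⟩
  obtain ⟨f, hf, hmin⟩ := P.exists_min_image φ hne
  obtain ⟨g, hg, hmax⟩ := P.exists_max_image φ hne
  refine ⟨f, hf, g, hg, fun h hh => ⟨hmin h hh, hmax h hh⟩, ?_⟩
  have : P.image φ = Finset.Icc (φ f) (φ g) := by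
    ext m
    rw [Finset.mem_image, Finset.mem_Icc]
    constructor
    · rintro ⟨h, hh, rfl⟩
      exact ⟨hmin h hh, hmax h hh⟩
    · rintro ⟨h1, h2⟩
      exact hP.exists_eq φ hφ hf hg h1 h2
  rw [this, Int.card_Icc]
  have := hmin g hg
  omega

/-- The faces of an upward triangle of side `s`. -/
theorem sq_le_card_corner (x₀ y₀ : ℤ) (s : ℕ) (C : Finset Face)
    (hC : ∀ f : Face, x₀ ≤ f.1 → y₀ ≤ f.2.1 → diag f < x₀ + y₀ + s → f ∈ C) : s ^ 2 ≤ C.card := by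
  have h : ((Finset.range s) ×ˢ (Finset.range s)).card = s ^ 2 := by
    rw [Finset.card_product, Finset.card_range, sq]
  rw [← h]
  -- The half of the square with `q.1 + q.2 < s` indexes the upward faces; the other half, reflected
  -- through the centre, indexes the downward ones.
  refine Finset.card_le_card_of_injOn (fun q => if q.1 + q.2 < s then (x₀ + q.1, y₀ + q.2, true)
    else (x₀ + (s - 1 - q.1), y₀ + (s - 1 - q.2), false)) ?_ ?_
  · rintro ⟨i, j⟩ hq
    simp only [Finset.coe_product, Finset.coe_range, Set.mem_prod, Set.mem_Iio] at hq
    dsimp only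
    split_ifs with hlt <;> apply hC <;> simp [diag] <;> omega
  · rintro ⟨i, j⟩ hq ⟨i', j'⟩ hq' heq
    dsimp only at heq
    simp only [Prod.mk.injEq]
    split_ifs at heq <;> simp at heq <;> omega

/-- The faces of a downward triangle of side `s`. -/
theorem sq_le_card_opposite_corner (x₁ y₁ : ℤ) (s : ℕ) (C : Finset Face)
    (hC : ∀ f : Face, f.1 ≤ x₁ → f.2.1 ≤ y₁ → x₁ + y₁ + 1 - s < diag f → f ∈ C) :
    s ^ 2 ≤ C.card := by
  have h : ((Finset.range s) ×ˢ (Finset.range s)).card = s ^ 2 := by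
    rw [Finset.card_product, Finset.card_range, sq]
  rw [← h]
  refine Finset.card_le_card_of_injOn (fun q => if q.1 + q.2 < s then (x₁ - q.1, y₁ - q.2, false)
    else (x₁ - (s - 1 - q.1), y₁ - (s - 1 - q.2), true)) ?_ ?_
  · rintro ⟨i, j⟩ hq
    simp only [Finset.coe_product, Finset.coe_range, Set.mem_prod, Set.mem_Iio] at hq
    dsimp only
    split_ifs with hlt <;> apply hC <;> simp [diag] <;> omega
  · rintro ⟨i, j⟩ hq ⟨i', j'⟩ hq' heq
    dsimp only at heq
    simp only [Prod.mk.injEq]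
    split_ifs at heq <;> simp at heq <;> omega

theorem diag_eq (f : Face) : diag f = f.1 + f.2.1 + if f.2.2 then 0 else 1 := by
  obtain ⟨x, y, _ | _⟩ := f <;> simp [diag]

/-- The isoperimetric inequality for polyiamonds. -/
theorem IsPolyiamond.six_mul_card_le {P : Finset Face} (hP : IsPolyiamond P) :
    6 * P.card ≤ perimeter P ^ 2 := by
  obtain ⟨f₁, hf₁, g₁, hg₁, hx, hxc⟩ := hP.exists_extremes (fun f => f.1)
    (by intro j ⟨x, y, b⟩; fin_cases j <;> cases b <;> simp [flip]; omega)
  obtain ⟨f₂, hf₂, g₂, hg₂, hy, hyc⟩ := hP.exists_extremes (fun f => f.2.1)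
    (by intro j ⟨x, y, b⟩; fin_cases j <;> cases b <;> simp [flip]; omega)
  obtain ⟨f₃, hf₃, g₃, hg₃, hd, hdc⟩ := hP.exists_extremes diag
    (by intro j ⟨x, y, b⟩; fin_cases j <;> cases b <;> simp [flip, diag] <;> omega)
  have hle := card_rows_le_perimeter P
  generalize (P.image fun f => f.1).card = a at hxc hle
  generalize (P.image fun f => f.2.1).card = b at hyc hle
  generalize (P.image diag).card = c at hdc hle
  have bound : ∀ f : Face, f.1 + f.2.1 ≤ diag f ∧ diag f ≤ f.1 + f.2.1 + 1 := fun f => by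
    rw [diag_eq]; split_ifs <;> omega
  -- `s` and `t` are the sides of the two corner triangles cut off by the extreme diagonal strips.
  obtain ⟨s, hs⟩ : ∃ s : ℕ, (s : ℤ) = diag f₃ - f₁.1 - f₂.2.1 := ⟨_, Int.toNat_of_nonneg (by
    have := bound f₃; have := hx f₃ hf₃; have := hy f₃ hf₃; omega)⟩
  obtain ⟨t, ht⟩ : ∃ t : ℕ, (t : ℤ) = g₁.1 + g₂.2.1 + 1 - diag g₃ := ⟨_, Int.toNat_of_nonneg (by
    have := bound g₃; have := hx g₃ hg₃; have := hy g₃ hg₃; omega)⟩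
  -- These four bounds keep both corner triangles inside the parallelogram `B`.
  have hsa : (s : ℤ) ≤ a := by
    have := bound f₂; have := hx f₂ hf₂; have := hd f₂ hf₂; omega
  have hsb : (s : ℤ) ≤ b := by
    have := bound f₁; have := hy f₁ hf₁; have := hd f₁ hf₁; omega
  have hta : (t : ℤ) ≤ a := by
    have := bound g₂; have := hx g₂ hg₂; have := hd g₂ hg₂; omega
  have htb : (t : ℤ) ≤ b := by
    have := bound g₁; have := hy g₁ hg₁; have := hd g₁ hg₁; omega
  set B : Finset Face := Finset.Icc f₁.1 g₁.1 ×ˢ (Finset.Icc f₂.2.1 g₂.2.1 ×ˢ Finset.univ) with hB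
  have hBc : B.card = a * (b * 2) := by
    rw [hB, Finset.card_product, Finset.card_product, Int.card_Icc, Int.card_Icc]
    simp only [Finset.card_univ, Fintype.card_bool]
    congr <;> omega
  have hmemB : ∀ f : Face, f ∈ B ↔ (f₁.1 ≤ f.1 ∧ f.1 ≤ g₁.1) ∧ f₂.2.1 ≤ f.2.1 ∧ f.2.1 ≤ g₂.2.1 :=
    fun f => by simp [hB]
  have h1 := sq_le_card_corner f₁.1 f₂.2.1 s (B.filter fun f => diag f < diag f₃)
    (fun f h1 h2 h3 => by
      have := bound f
      rw [Finset.mem_filter, hmemB]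
      omega)
  have h2 := sq_le_card_opposite_corner g₁.1 g₂.2.1 t (B.filter fun f => diag g₃ < diag f)
    (fun f h1 h2 h3 => by
      have := bound f
      rw [Finset.mem_filter, hmemB]
      omega)
  have h3 : P.card + (B.filter fun f => diag f < diag f₃).card +
      (B.filter fun f => diag g₃ < diag f).card ≤ B.card := by
    rw [← Finset.card_union_of_disjoint, ← Finset.card_union_of_disjoint]
    · refine Finset.card_le_card (Finset.union_subset (Finset.union_subset ?_ ?_) ?_)
      · exact fun f hf => (hmemB f).2 ⟨hx f hf, hy f hf⟩
      · exact Finset.filter_subset _ _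
      · exact Finset.filter_subset _ _
    · rw [Finset.disjoint_left]
      intro f hf hf'
      have h4 := (Finset.mem_filter.1 hf').2
      have h5 := (hd f₃ hf₃).2
      rcases Finset.mem_union.1 hf with h | h
      · exact absurd (hd f h).2 (not_le.2 h4)
      · have := (Finset.mem_filter.1 h).2
        omega
    · rw [Finset.disjoint_left]
      intro f hf hf'
      exact absurd (hd f hf).1 (not_le.2 (Finset.mem_filter.1 hf').2)
  have h4 : P.card + s ^ 2 + t ^ 2 ≤ a * (b * 2) := by omega
  have h5 : (s : ℤ) + t = a + b - c := by omega
  refine le_trans ?_ (Nat.pow_le_pow_left hle 2)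
  zify at h4 ⊢
  -- With s + t = a + b - c, the difference (a + b + c)² - 6(2ab - s² - t²) equals (a + b - 2c)² +
  -- 3(a - b)² + 3(s - t)².
  nlinarith [sq_nonneg ((s : ℤ) - t), sq_nonneg ((a : ℤ) - b), sq_nonneg ((a : ℤ) + b - 2 * c),
    congrArg (· ^ 2) h5]

/-! ### Bars and quasi-regular hexagons -/

/-- The number of faces of the bar that completes `quasiHexagon r i` to
`quasiHexagon r (i + 1)`. -/
def barLength (r i : ℕ) : ℕ :=
  if i = 0 then 2 * r - 1 else if i ≤ 4 then 2 * r + 1 else 2 * r + 3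

/-- The `n`-th face of the bar attached to `quasiHexagon r i`. -/
def barFace (r i n : ℕ) : Face :=
  rotate^[i] (topBarFace r (if i = 0 then -(r : ℤ) else -(r : ℤ) - 1) n)

theorem incompleteBar_zero (r i : ℕ) : incompleteBar r i 0 = ∅ := by simp [incompleteBar]

theorem incompleteBar_succ (r i n : ℕ) :
    incompleteBar r i (n + 1) = insert (barFace r i n) (incompleteBar r i n) := by
  simp [incompleteBar, barFace, Finset.range_add_one, Finset.image_insert]

theorem rotate_true (x y : ℤ) : rotate (x, y, true) = (x + y, -x - 1, false) := rfl

theorem rotate_false (x y : ℤ) : rotate (x, y, false) = (x + y + 1, -x - 1, true) := rfl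

theorem rotate_iterate_true (x y : ℤ) :
    rotate^[1] (x, y, true) = (x + y, -x - 1, false) ∧
    rotate^[2] (x, y, true) = (y, -x - y - 1, true) ∧
    rotate^[3] (x, y, true) = (-x - 1, -y - 1, false) ∧
    rotate^[4] (x, y, true) = (-x - y - 1, x, true) ∧
    rotate^[5] (x, y, true) = (-y - 1, x + y, false) ∧
    rotate^[6] (x, y, true) = (x, y, true) := by
  simp [rotate]; omega

theorem rotate_iterate_false (x y : ℤ) :
    rotate^[1] (x, y, false) = (x + y + 1, -x - 1, true) ∧
    rotate^[2] (x, y, false) = (y, -x - y - 2, false) ∧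
    rotate^[3] (x, y, false) = (-x - 1, -y - 1, true) ∧
    rotate^[4] (x, y, false) = (-x - y - 2, x, false) ∧
    rotate^[5] (x, y, false) = (-y - 1, x + y + 1, true) ∧
    rotate^[6] (x, y, false) = (x, y, false) := by
  simp [rotate]; omega

theorem rotate_iterate_six (f : Face) : rotate^[6] f = f := by
  obtain ⟨x, y, _ | _⟩ := f <;> simp [rotate_iterate_true, rotate_iterate_false]

theorem rotate_iterate_eq_iff {i : ℕ} (hi : i ≤ 6) (f g : Face) :
    rotate^[i] f = g ↔ f = rotate^[6 - i] g := by
  constructor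
  · rintro rfl
    rw [← Function.iterate_add_apply, Nat.sub_add_cancel hi, rotate_iterate_six]
  · rintro rfl
    rw [← Function.iterate_add_apply, Nat.add_sub_cancel' hi, rotate_iterate_six]

theorem exists_topBarFace_eq (r : ℕ) (s : ℤ) (k : ℕ) (f : Face) :
    (∃ n < k, topBarFace r s n = f) ↔
      f.2.1 = r ∧ 2 * s ≤ 2 * f.1 + (if f.2.2 then 0 else 1) ∧
        2 * f.1 + (if f.2.2 then 0 else 1) < 2 * s + k := by
  obtain ⟨x, y, b⟩ := f
  simp only [topBarFace, Prod.mk.injEq]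
  constructor
  · rintro ⟨n, hn, rfl, rfl, rfl⟩
    rcases Nat.even_or_odd' n with ⟨m, rfl | rfl⟩
    · simp; omega
    · have h : ¬ Even (2 * m + 1) := by simp
      simp [h]; omega
  · rintro ⟨rfl, h1, h2⟩
    cases b
    · simp at h1 h2
      refine ⟨2 * (x - s).toNat + 1, by omega, by omega, rfl, by simp⟩
    · simp at h1 h2
      refine ⟨2 * (x - s).toNat, by omega, by omega, rfl, by simp⟩

/-- Since `rotate` has order six, `6 - i` further rotations bring the bar back to the top, where it
is described by inequalities. -/
theorem mem_incompleteBar {r i k : ℕ} (hi : i ≤ 6) (f : Face) :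
    f ∈ incompleteBar r i k ↔
      (rotate^[6 - i] f).2.1 = r ∧
      2 * (if i = 0 then -(r : ℤ) else -(r : ℤ) - 1) ≤
        2 * (rotate^[6 - i] f).1 + (if (rotate^[6 - i] f).2.2 then 0 else 1) ∧
      2 * (rotate^[6 - i] f).1 + (if (rotate^[6 - i] f).2.2 then 0 else 1) <
        2 * (if i = 0 then -(r : ℤ) else -(r : ℤ) - 1) + k := by
  rw [← exists_topBarFace_eq]
  simp [incompleteBar, rotate_iterate_eq_iff hi]

theorem mem_quasiHexagon {r i : ℕ} (f : Face) : f ∈ quasiHexagon r i ↔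
    f.2.1 < (r : ℤ) + (if 1 ≤ i then 1 else 0) ∧
    diag f < (r : ℤ) + (if 2 ≤ i then 1 else 0) ∧
    f.1 < (r : ℤ) + (if 3 ≤ i then 1 else 0) ∧
    -(r : ℤ) - (if 4 ≤ i then 1 else 0) ≤ f.2.1 ∧
    -(r : ℤ) - (if 5 ≤ i then 1 else 0) ≤ diag f ∧
    -(r : ℤ) - (if 6 ≤ i then 1 else 0) ≤ f.1 := by
  obtain ⟨x, y, b⟩ := f
  simp only [quasiHexagon, Finset.mem_filter, Finset.mem_product, Finset.mem_Icc,
    Finset.mem_univ, and_true]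
  refine ⟨fun h => h.2, fun h => ⟨?_, h⟩⟩
  split_ifs at h <;> omega

theorem quasiHexagon_succ {r i : ℕ} (hi : i ≤ 5) (hr : 1 ≤ r ∨ 3 ≤ i) :
    quasiHexagon r (i + 1) = quasiHexagon r i ∪ incompleteBar r i (barLength r i) := by
  ext ⟨x, y, b⟩
  rw [Finset.mem_union, mem_quasiHexagon, mem_quasiHexagon, mem_incompleteBar (by omega)]
  interval_cases i <;> cases b <;> simp [rotate_true, rotate_false, rotate_iterate_true,
      rotate_iterate_false, diag, barLength] <;> omega

theorem quasiHexagon_six (r : ℕ) : quasiHexagon r 6 = quasiHexagon (r + 1) 0 := by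
  ext f
  rw [mem_quasiHexagon, mem_quasiHexagon]
  simp
  omega

theorem barFace_even (r i m : ℕ) : barFace r i (2 * m) =
    rotate^[i] ((if i = 0 then -(r : ℤ) else -(r : ℤ) - 1) + m, (r : ℤ), true) := by
  simp [barFace, topBarFace]

theorem barFace_odd (r i m : ℕ) : barFace r i (2 * m + 1) =
    rotate^[i] ((if i = 0 then -(r : ℤ) else -(r : ℤ) - 1) + m, (r : ℤ), false) := by
  have h : (2 * m + 1) / 2 = m := by omega
  simp [barFace, topBarFace, h]

theorem barFace_notMem {r i n : ℕ} (hi : i ≤ 5) :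
    barFace r i n ∉ quasiHexagon r i ∪ incompleteBar r i n := by
  rw [Finset.mem_union, mem_quasiHexagon, mem_incompleteBar (by omega)]
  rcases Nat.even_or_odd' n with ⟨m, rfl | rfl⟩
  · rw [barFace_even]
    interval_cases i <;> simp [rotate_true, rotate_false, rotate_iterate_true,
      rotate_iterate_false, diag] <;> omega
  · rw [barFace_odd]
    interval_cases i <;> simp [rotate_true, rotate_false, rotate_iterate_true,
      rotate_iterate_false, diag] <;> omega

/-- Even-indexed faces have their base on the side of the hexagon, odd-indexed ones do not, and
every face but the first meets its predecessor. A rotation by π/3 shifts the edge directions by one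
mod 3. -/
theorem flip_barFace_mem {r i n : ℕ} (hi : i ≤ 5) (hr : 1 ≤ r ∨ 3 ≤ i)
    (hn : n < barLength r i) (j : Fin 3) :
    flip j (barFace r i n) ∈ quasiHexagon r i ∪ incompleteBar r i n ↔
      if Odd n then (j : ℕ) = i % 3 else (j : ℕ) = (i + 2) % 3 ∨ n ≠ 0 ∧ (j : ℕ) = (i + 1) % 3 := by
  simp only [Finset.mem_union, mem_quasiHexagon, mem_incompleteBar (show i ≤ 6 by omega)]
  simp only [barLength] at hn
  rcases Nat.even_or_odd' n with ⟨m, rfl | rfl⟩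
  · rw [barFace_even, if_neg (show ¬ Odd (2 * m) by simp)]
    interval_cases i <;> fin_cases j <;>
      simp [rotate_true, rotate_iterate_true, rotate_iterate_false, diag, flip]
        at hn ⊢ <;> omega
  · rw [barFace_odd, if_pos (show Odd (2 * m + 1) by simp)]
    interval_cases i <;> fin_cases j <;>
      simp [rotate_false, rotate_iterate_true, rotate_iterate_false, diag, flip]
        at hn ⊢ <;> omega

theorem card_neighbours_barFace {r i n : ℕ} (hi : i ≤ 5) (hr : 1 ≤ r ∨ 3 ≤ i)
    (hn : n < barLength r i) :
    (Finset.univ.filter fun j =>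
      flip j (barFace r i n) ∈ quasiHexagon r i ∪ incompleteBar r i n).card =
      if n = 0 ∨ Odd n then 1 else 2 := by
  simp only [flip_barFace_mem hi hr hn]
  by_cases h : Odd n
  · simp only [h, if_true, or_true]
    interval_cases i <;> decide
  · by_cases h0 : n = 0
    · simp only [h0, if_true, true_or, ne_eq, not_true, false_and, or_false]
      interval_cases i <;> decide
    · simp only [h, h0, if_false, or_false, ne_eq, not_false_iff, true_and]
      interval_cases i <;> decide

/-! ### Area, perimeter and connectedness of the construction -/

theorem isPolyiamond_singleton (f : Face) : IsPolyiamond {f} := by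
  rw [IsPolyiamond, Finset.coe_singleton]
  exact SimpleGraph.Connected.of_subsingleton

theorem IsPolyiamond.insert {P : Finset Face} (hP : IsPolyiamond P) {f : Face} {j : Fin 3}
    (hj : flip j f ∈ P) : IsPolyiamond (insert f P) := by
  have h : faceGraph.Adj (flip j f) f := faceGraph_adj.2 ⟨j, (flip_flip j f).symm⟩
  have h2 := SimpleGraph.connected_induce_union hP.preconnected
    (isPolyiamond_singleton f).preconnected hj (Finset.mem_coe.2 (Finset.mem_singleton_self f)) h
  rw [← Finset.coe_union, Finset.union_comm, ← Finset.insert_eq] at h2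
  exact h2

/-- Adding a partial bar to a quasi-regular hexagon. -/
theorem union_incompleteBar {r i n : ℕ} (hi : i ≤ 5) (hr : 1 ≤ r ∨ 3 ≤ i)
    (hn : n ≤ barLength r i) (hQ : IsPolyiamond (quasiHexagon r i)) :
    IsPolyiamond (quasiHexagon r i ∪ incompleteBar r i n) ∧
    (quasiHexagon r i ∪ incompleteBar r i n).card = (quasiHexagon r i).card + n ∧
    perimeter (quasiHexagon r i ∪ incompleteBar r i n) =
      perimeter (quasiHexagon r i) + (if 0 < n then 1 else 0) +
        (if 0 < n ∧ Even n then 1 else 0) := by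
  induction n with
  | zero => simpa [incompleteBar_zero] using hQ
  | succ n ih =>
    obtain ⟨h1, h2, h3⟩ := ih (by omega)
    have hf := barFace_notMem (r := r) (n := n) hi
    have hcard := card_neighbours_barFace (r := r) (n := n) hi hr (by omega)
    have hp := perimeter_insert hf
    rw [hcard] at hp
    rw [incompleteBar_succ, Finset.union_insert]
    obtain ⟨j, hj⟩ := Finset.card_pos.1 (hcard.symm ▸ by split_ifs <;> simp :
      0 < (Finset.univ.filter fun j =>
        flip j (barFace r i n) ∈ quasiHexagon r i ∪ incompleteBar r i n).card)
    refine ⟨h1.insert (Finset.mem_filter.1 hj).2, ?_, ?_⟩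
    · rw [Finset.card_insert_of_notMem hf, h2, add_assoc]
    · rcases Nat.eq_zero_or_pos n with rfl | h0
      · simp at hp h3 ⊢
        omega
      · rcases Nat.even_or_odd n with he | ho
        · have h4 : ¬ Odd n := by simpa using he
          have h5 : ¬ Even (n + 1) := by simpa using he.add_one
          simp [h4, h5, he, h0, h0.ne'] at hp h3 ⊢
          omega
        · have h4 : ¬ Even n := by simpa using ho
          have h5 : Even (n + 1) := ho.add_one
          simp [h4, h5, ho, h0] at hp h3 ⊢
          omega

/-- The number of faces in the first `i` bars around the regular hexagon of radius `r`. -/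
def barSum (r : ℕ) (i : ℕ) : ℤ :=
  if i = 0 then 0 else if i ≤ 5 then 2 * r - 1 + (i - 1) * (2 * r + 1)
  else 12 * r + 6

/-- The bar has odd length, so `union_incompleteBar` gives an increase of exactly one in the
perimeter. -/
theorem quasiHexagon_step {r i : ℕ} (hi : i ≤ 5) (hr : 1 ≤ r ∨ 3 ≤ i)
    (h : IsPolyiamond (quasiHexagon r i) ∧
      ((quasiHexagon r i).card : ℤ) = 6 * r ^ 2 + barSum r i ∧
      perimeter (quasiHexagon r i) = 6 * r + i) :
    IsPolyiamond (quasiHexagon r (i + 1)) ∧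
      ((quasiHexagon r (i + 1)).card : ℤ) = 6 * r ^ 2 + barSum r (i + 1) ∧
      perimeter (quasiHexagon r (i + 1)) = 6 * r + (i + 1 : ℕ) := by
  obtain ⟨h1, h2, h3⟩ := union_incompleteBar hi hr le_rfl h.1
  rw [← quasiHexagon_succ hi hr] at h1 h2 h3
  refine ⟨h1, ?_, ?_⟩
  · rw [h2, Nat.cast_add, h.2.1]
    interval_cases i <;> simp [barLength, barSum] <;> omega
  · have ho : Odd (barLength r i) := by
      rw [Nat.odd_iff]
      unfold barLength
      split_ifs <;> omega
    have hpos := ho.pos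
    have hne : ¬ Even (barLength r i) := by simpa using ho
    rw [h3, h.2.2]
    simp [hpos, hne, add_assoc]

theorem quasiHexagon_props {r : ℕ} : ∀ {i : ℕ}, i ≤ 6 → (1 ≤ r ∨ 3 ≤ i) →
    IsPolyiamond (quasiHexagon r i) ∧
      ((quasiHexagon r i).card : ℤ) = 6 * r ^ 2 + barSum r i ∧
      perimeter (quasiHexagon r i) = 6 * r + i := by
  induction r with
  | zero =>
    -- For r = 0 the first bar would have length -1 and the hexagons with i ≤ 2 are empty, so the
    -- construction starts from a single face at i = 3, where `barSum` is -1 + 1 + 1.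
    have base : quasiHexagon 0 3 = {(0, 0, true)} := by
      ext ⟨x, y, b⟩
      rw [mem_quasiHexagon]
      cases b <;> simp [diag] <;> omega
    have h3 : IsPolyiamond (quasiHexagon 0 3) ∧
      ((quasiHexagon 0 3).card : ℤ) = 6 * (0 : ℕ) ^ 2 + barSum 0 3 ∧
      perimeter (quasiHexagon 0 3) = 6 * 0 + 3 := by
      rw [base]
      refine ⟨isPolyiamond_singleton _, by simp [barSum], ?_⟩
      simpa [perimeter_empty] using perimeter_insert (Finset.notMem_empty ((0, 0, true) : Face))
    intro i hi hr
    have hr : 3 ≤ i := by omega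
    induction i, hr using Nat.le_induction with
    | base => exact h3
    | succ i hi' ih => exact quasiHexagon_step (by omega) (.inr hi') (ih (by omega) (.inr hi'))
  | succ r ihr =>
    have h0 := ihr (i := 6) le_rfl (.inr (by norm_num))
    rw [quasiHexagon_six] at h0
    intro i hi _
    induction i with
    | zero =>
      refine ⟨h0.1, ?_, ?_⟩
      · rw [h0.2.1]
        simp [barSum]
        ring
      · rw [h0.2.2]
        ring
    | succ i ih =>
      exact quasiHexagon_step (by omega) (.inl (by omega)) (ih (by omega) (.inl (by omega)))

/-! ### Arithmetic of the optimal value -/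

/-- The value of the perimeter of the standard polyiamond cannot be lowered by two. -/
theorem le_of_six_mul_le_sq {A r i k q : ℕ} (hi : i ≤ 5) (hr : 1 ≤ r ∨ 3 ≤ i)
    (hA : (A : ℤ) = 6 * r ^ 2 + barSum r i + k) (hq : 6 * A ≤ q ^ 2)
    (hmod : q % 2 = (6 * r + i + (if 0 < k then 1 else 0) +
      (if 0 < k ∧ Even k then 1 else 0)) % 2) :
    6 * r + i + (if 0 < k then 1 else 0) + (if 0 < k ∧ Even k then 1 else 0) ≤ q := by
  by_contra! hlt
  have hle : (q : ℤ) ≤ 6 * r + i + (if 0 < k then 1 else 0) +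
      (if 0 < k ∧ Even k then 1 else 0) - 2 := by
    split_ifs at hmod hlt ⊢ <;> omega
  have hsq := pow_le_pow_left₀ (Int.natCast_nonneg q) hle 2
  have hq' : (6 : ℤ) * A ≤ (q : ℤ) ^ 2 := by exact_mod_cast hq
  rw [hA] at hq'
  replace hq' := hq'.trans hsq
  rcases Nat.eq_zero_or_pos k with rfl | hk
  · interval_cases i <;> simp [barSum] at hq' <;> ring_nf at hq' <;> omega
  · by_cases he : Even k
    · have : 2 ≤ k := by
        obtain ⟨m, rfl⟩ := he
        omega
      interval_cases i <;> simp [barSum, hk, he] at hq' <;> ring_nf at hq' <;> omega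
    · interval_cases i <;> simp [barSum, hk, he] at hq' <;> ring_nf at hq' <;> omega

theorem radius_spec (A : ℕ) : 6 * radius A ^ 2 ≤ A ∧ A < 6 * (radius A + 1) ^ 2 := by
  have h1 := Nat.sqrt_le' (A / 6)
  have h2 := Nat.lt_succ_sqrt' (A / 6)
  rw [radius]
  constructor
  · omega
  · rw [Nat.succ_eq_add_one] at h2
    omega

theorem barCount_spec {A : ℕ} (hA : 0 < A) : barCount A ≤ 5 ∧ (1 ≤ radius A ∨ 3 ≤ barCount A) ∧
    6 * (radius A : ℤ) ^ 2 + barSum (radius A) (barCount A) ≤ A ∧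
    (A : ℤ) < 6 * (radius A : ℤ) ^ 2 + barSum (radius A) (barCount A) +
      barLength (radius A) (barCount A) := by
  obtain ⟨h1, h2⟩ := radius_spec A
  have h2' : (A : ℤ) < 6 * (radius A : ℤ) ^ 2 + 12 * radius A + 6 := by
    zify at h2
    linarith
  have h1' : 6 * (radius A : ℤ) ^ 2 ≤ A := by exact_mod_cast h1
  have h3 : radius A = 0 → (radius A : ℤ) ^ 2 = 0 := by
    intro h
    simp [h]
  simp only [barCount]
  -- Treating the square as a variable makes all goals linear; `h3` retains the one fact needed when
  -- the radius is 0.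
  generalize (radius A : ℤ) ^ 2 = R at *
  generalize radius A = r at *
  split_ifs <;> simp [barSum, barLength] <;> omega

end Polyiamond

theorem theorem1 (A : ℕ) :
    (0 < A → Polyiamond.IsPolyiamond (Polyiamond.standard A)) ∧
    Polyiamond.area (Polyiamond.standard A) = A ∧
    Polyiamond.perimeter (Polyiamond.standard A) =
      6 * Polyiamond.radius A + Polyiamond.barCount A
        + (if 0 < Polyiamond.remainder A then 1 else 0)
        + (if 0 < Polyiamond.remainder A ∧ Even (Polyiamond.remainder A) then 1 else 0) ∧
    ∀ P : Finset Polyiamond.Face, Polyiamond.IsPolyiamond P → Polyiamond.area P = A →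
      Polyiamond.perimeter (Polyiamond.standard A) ≤ Polyiamond.perimeter P := by
  open Polyiamond in
  rcases Nat.eq_zero_or_pos A with rfl | hA
  -- A = 0 is separate: it gives r = i = 0, where the hexagon is empty and `quasiHexagon_props` does
  -- not apply.
  · have hr : radius 0 = 0 := by simp [radius]
    have hi : barCount 0 = 0 := by simp [barCount, hr]
    have hk : remainder 0 = 0 := by simp [remainder]
    have hS : standard 0 = ∅ := by
      rw [standard, hr, hi, hk, incompleteBar_zero, Finset.union_empty]
      ext f
      rw [mem_quasiHexagon]
      simp
      omega
    rw [hS, hr, hi, hk, perimeter_empty]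
    simp [area]
  · obtain ⟨hi, hr, h1, h2⟩ := barCount_spec hA
    obtain ⟨hQ, hQc, hQp⟩ := quasiHexagon_props (show barCount A ≤ 6 by omega) hr
    have hk : (A : ℤ) = 6 * radius A ^ 2 + barSum (radius A) (barCount A) + remainder A := by
      rw [remainder, area]
      omega
    obtain ⟨hS, hSc, hSp⟩ := union_incompleteBar hi hr (n := remainder A) (by omega) hQ
    have hcard : (standard A).card = A := by
      rw [standard]
      omega
    rw [hQp] at hSp
    refine ⟨fun _ => hS, hcard, hSp, fun P hP hPA => ?_⟩
    have hmod : perimeter P % 2 = perimeter (standard A) % 2 := by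
      rw [perimeter_mod_two, perimeter_mod_two, hcard, ← hPA, area]
    have hiso := hP.six_mul_card_le
    rw [← area, hPA] at hiso
    rw [show perimeter (standard A) = _ from hSp] at hmod ⊢
    exact le_of_six_mul_le_sq hi hr hk hiso hmod
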